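/- **Theorem 12.1 (positivity).** Let $X$ be a complex manifold and let $\mathbb V$ be a variation of Hodge structure of weight $-1$ over $X$ whose underlying local system $\mathbb V_{\mathbb Z}$ consists of free abelian groups of rank $n$. Write $\mathcal V=\mathbb V\otimes\mathcal O_X$ for its flat holomorphic bundle, $\nabla$ for the flat connection and $\mathcal F^\bullet$ for the Hodge filtration. Let $S$ be a weak polarization of $\mathbb V$: a flat, skew-symmetric real-valued (for example, rational-valued) bilinear form on $\mathbb V$ such that, on each fibre, $S(V^{p,q},\overline{V^{r,s}})=0$ unless $(p,q)=(r,s)$, and $i^{p-q}S(v,\bar v)\ge 0$ for all $v\in V^{p,q}$. Let $J(\mathbb V)=\mathcal V/(\mathcal F^0+\mathbb V_{\mathbb Z})\to X$ be the bundle of intermediate jacobians. As a bundle of real tori, $J(\mathbb V)=\mathbb V_{\mathbb R}/\mathbb V_{\mathbb Z}$; let $\omega_S$ be the 2-form on $J(\mathbb V)$ that is parallel with respect to this flat structure, vanishes on its leaves, and restricts on each fibre to the translation-invariant 2-form $S$. Let $\nu$ be a normal function section of $J(\mathbb V)$, that is, a holomorphic section such that the corresponding extension $0\to\mathbb V\to\mathbb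 E\to\mathbb Z(0)\to 0$ is a variation of mixed Hodge structure, i.e. its Hodge filtration satisfies Griffiths transversality $\nabla\mathcal F^p\mathbb E\subseteq\mathcal F^{p-1}\mathbb E\otimes\Omega^1_X$ (no admissibility at infinity is required). Then the pullback $\nu^*\omega_S$ is a well-defined smooth 2-form on $X$, it is of type $(1,1)$, and it is non-negative: $\nu^*\omega_S(u,Ju)\ge 0$ for every real tangent vector $u$ of $X$, where $J$ is the complex structure. -/

import Mathlib

open scoped Manifold ContDiff TensorProduct ComplexOrder Topology

noncomputable section

namespace NormalFunction

/-! ### Linear algebra: complexified lattices and Hodge structures -/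

section Linear

variable {M : Type*} [AddCommGroup M]

/-- Complex conjugation `z ⊗ m ↦ conj z ⊗ m` on `M_ℂ = ℂ ⊗ M`. -/
def conjC (M : Type*) [AddCommGroup M] :
    (ℂ ⊗[ℤ] M) →ₛₗ[starRingEnd ℂ] (ℂ ⊗[ℤ] M) where
  toFun := ((starRingEnd ℂ).toAddMonoidHom.toIntLinearMap).rTensor M
  map_add' := map_add _
  map_smul' := by
    intro a v
    induction v with
    | zero => simp
    | tmul z m => simp [TensorProduct.smul_tmul']
    | add v w hv hw => simp only [smul_add, map_add, hv, hw]

@[simp] theorem conjC_tmul (z : ℂ) (m : M) :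
    conjC M (z ⊗ₜ[ℤ] m) = (starRingEnd ℂ z) ⊗ₜ[ℤ] m := rfl

/-- The complex conjugate `{v | conj v ∈ W}` of a complex subspace `W ⊆ M_ℂ`. -/
def conjSubspace (W : Submodule ℂ (ℂ ⊗[ℤ] M)) : Submodule ℂ (ℂ ⊗[ℤ] M) :=
  W.comap (conjC M)

/-- `F` is the Hodge filtration of a Hodge structure of weight `k` on the lattice `M`:
a finite decreasing filtration with `M_ℂ = F^p ⊕ conj F^q` whenever `p + q = k + 1`. -/
structure IsHodgeFiltration (k : ℤ) (F : ℤ → Submodule ℂ (ℂ ⊗[ℤ] M)) : Prop where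
  antitone : Antitone F
  exists_eq_top : ∃ p, F p = ⊤
  exists_eq_bot : ∃ p, F p = ⊥
  isCompl : ∀ p q, p + q = k + 1 → IsCompl (F p) (conjSubspace (F q))

/-- The Hodge component `H^{p,q} = F^p ∩ conj F^q` (used when `p + q` is the weight). -/
def hodgePart (F : ℤ → Submodule ℂ (ℂ ⊗[ℤ] M)) (p q : ℤ) : Submodule ℂ (ℂ ⊗[ℤ] M) :=
  F p ⊓ conjSubspace (F q)

/-- The complex bilinear extension to `M_ℂ` of a biadditive form `S : M × M → ℝ`
(equivalently, of a real bilinear form on `M_ℝ`). -/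
def complexify (S : M →ₗ[ℤ] M →ₗ[ℤ] ℝ) : (ℂ ⊗[ℤ] M) →ₗ[ℂ] (ℂ ⊗[ℤ] M) →ₗ[ℂ] ℂ :=
  LinearMap.liftBaseChange ℂ
    { toFun := fun m =>
        LinearMap.liftBaseChange ℂ (Complex.ofRealHom.toAddMonoidHom.toIntLinearMap ∘ₗ S m)
      map_add' := fun m m' => by
        apply TensorProduct.AlgebraTensorModule.ext
        intro z v
        simp [mul_add]
      map_smul' := fun a m => by
        apply TensorProduct.AlgebraTensorModule.ext
        intro z v
        simp [mul_left_comm] }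

@[simp] theorem complexify_tmul (S : M →ₗ[ℤ] M →ₗ[ℤ] ℝ) (a b : ℂ) (u v : M) :
    complexify S (a ⊗ₜ[ℤ] u) (b ⊗ₜ[ℤ] v) = a * b * (S u v : ℂ) := by
  simp [complexify, mul_assoc]

/-- `S` is a weak polarization of the Hodge structure of weight `k` on `M` with Hodge
filtration `F`: it is `(-1)^k`-symmetric, `S(H^{p,q}, conj H^{r,s}) = 0` unless
`(p,q) = (r,s)`, and `i^{p-q} S(v, conj v) ≥ 0` for all `v ∈ H^{p,q}`. Real-valued forms
are allowed; rational ones are a special case. -/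
structure IsWeakPolarization (k : ℤ) (F : ℤ → Submodule ℂ (ℂ ⊗[ℤ] M))
    (S : M →ₗ[ℤ] M →ₗ[ℤ] ℝ) : Prop where
  symm : ∀ u v, S u v = (-1 : ℝ) ^ k * S v u
  orthogonal : ∀ p q r s : ℤ, p + q = k → r + s = k → (p, q) ≠ (r, s) →
    ∀ v ∈ hodgePart F p q, ∀ w ∈ hodgePart F r s, complexify S v (conjC M w) = 0
  nonneg : ∀ p q : ℤ, p + q = k → ∀ v ∈ hodgePart F p q,
    0 ≤ Complex.I ^ (p - q) * complexify S v (conjC M v)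

end Linear

/-! ### Local systems of lattices -/

/-- A local system of free abelian groups of rank `n` on `X`, given by its fibres and, over
an open neighbourhood `dom a` of each point `a`, a frame of flat sections; the transition
matrices between two such frames are locally constant. (The value of `frame a` at points
outside `dom a` carries no information.) -/
structure LocalSystem (X : Type*) [TopologicalSpace X] (n : ℕ) where
  fiber : X → Type*
  [addCommGroup : ∀ x, AddCommGroup (fiber x)]
  dom : X → Set X
  isOpen_dom : ∀ a, IsOpen (dom a)
  mem_dom : ∀ a, a ∈ dom a
  frame : ∀ _a : X, ∀ y : X, Module.Basis (Fin n) ℤ (fiber y)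
  transition : ∀ a b : X, ∀ y ∈ dom a ∩ dom b, ∀ᶠ z in 𝓝 y,
    (frame a z).toMatrix (frame b z) = (frame a y).toMatrix (frame b y)

attribute [instance] LocalSystem.addCommGroup

namespace LocalSystem

variable {X : Type*} [TopologicalSpace X] {n : ℕ} (L : LocalSystem X n)

/-- The fibre at `x` of the flat complex vector bundle `𝒱 = 𝕍 ⊗ 𝒪_X`. -/
abbrev fiberC (x : X) : Type _ := ℂ ⊗[ℤ] L.fiber x

/-- The flat frame of `𝒱` over `dom a`. -/
def frameC (a y : X) : Module.Basis (Fin n) ℂ (L.fiberC y) := (L.frame a y).baseChange ℂ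

/-- Coordinates in the flat frame over `dom a` of a section of `𝒱`. -/
def coord (a : X) (σ : ∀ y, L.fiberC y) (y : X) : Fin n → ℂ := (L.frameC a y).equivFun (σ y)

/-- The point with coordinates `c` in the flat frame over `dom a`. -/
def ofCoord (a y : X) (c : Fin n → ℂ) : L.fiberC y := (L.frameC a y).equivFun.symm c

variable {E : Type*} [NormedAddCommGroup E] [NormedSpace ℂ E] [ChartedSpace E X]

/-- The section `σ` of `𝒱` is holomorphic on `U ⊆ dom a`. -/
def IsHolomorphicOn (a : X) (σ : ∀ y, L.fiberC y) (U : Set X) : Prop :=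
  ContMDiffOn 𝓘(ℂ, E) 𝓘(ℂ, Fin n → ℂ) ω (L.coord a σ) U

/-- The covariant derivative `∇_u σ` at `y ∈ dom a` for the flat connection of `𝒱`. -/
def nabla (a : X) (σ : ∀ y, L.fiberC y) (y : X) (u : TangentSpace 𝓘(ℂ, E) y) : L.fiberC y :=
  L.ofCoord a y (mfderiv 𝓘(ℂ, E) 𝓘(ℂ, Fin n → ℂ) (L.coord a σ) y u)

end LocalSystem

/-! ### Variations of Hodge structure -/

/-- A variation of Hodge structure of weight `k` (with torsion-free lattice of rank `n`) over
a complex manifold `X` modelled on `E`. -/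
structure VHS (E : Type*) [NormedAddCommGroup E] [NormedSpace ℂ E]
    (X : Type*) [TopologicalSpace X] [ChartedSpace E X] (n : ℕ) (k : ℤ)
    extends LocalSystem X n where
  /-- the Hodge filtration -/
  F : ℤ → ∀ x, Submodule ℂ (toLocalSystem.fiberC x)
  /-- each fibre is a Hodge structure of weight `k` -/
  isHodge : ∀ x, IsHodgeFiltration k fun p => F p x
  /-- each `F^p` is a holomorphic subbundle: it has local holomorphic frames -/
  holomorphic : ∀ (p : ℤ) (x : X), ∃ U : Set X, IsOpen U ∧ x ∈ U ∧ U ⊆ dom x ∧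
    ∃ (r : ℕ) (g : Fin r → ∀ y, toLocalSystem.fiberC y),
      (∀ i, toLocalSystem.IsHolomorphicOn (E := E) x (g i) U) ∧
      ∀ y ∈ U, LinearIndependent ℂ (fun i => g i y) ∧
        Submodule.span ℂ (Set.range fun i => g i y) = F p y
  /-- Griffiths transversality `∇ F^p ⊆ F^{p-1} ⊗ Ω¹` -/
  transversal : ∀ (p : ℤ) (a : X) (U : Set X), IsOpen U → U ⊆ dom a →
    ∀ σ : ∀ y, toLocalSystem.fiberC y, toLocalSystem.IsHolomorphicOn (E := E) a σ U →
      (∀ y ∈ U, σ y ∈ F p y) →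
      ∀ y ∈ U, ∀ u : TangentSpace 𝓘(ℂ, E) y, toLocalSystem.nabla a σ y u ∈ F (p - 1) y

namespace VHS

variable {E : Type*} [NormedAddCommGroup E] [NormedSpace ℂ E]
  {X : Type*} [TopologicalSpace X] [ChartedSpace E X] {n : ℕ} {k : ℤ}

/-- A weak polarization of a variation of Hodge structure: a flat bilinear form that is a weak
polarization on each fibre. -/
structure WeakPolarization (V : VHS E X n k) where
  form : ∀ x, V.fiber x →ₗ[ℤ] V.fiber x →ₗ[ℤ] ℝ
  flat : ∀ a : X, ∀ y ∈ V.dom a, ∀ᶠ z in 𝓝 y, ∀ i j,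
    form z (V.frame a z i) (V.frame a z j) = form y (V.frame a y i) (V.frame a y j)
  isWeakPolarization : ∀ x, IsWeakPolarization k (fun p => V.F p x) (form x)

/-! ### The bundle of intermediate jacobians and its sections -/

/-- The subgroup `V_ℤ + F^0 V_ℂ` of `V_ℂ` at the point `x`. -/
def periods (V : VHS E X n k) (x : X) : AddSubgroup (V.fiberC x) :=
  (TensorProduct.mk ℤ ℂ (V.fiber x) 1).toAddMonoidHom.range ⊔ (V.F 0 x).toAddSubgroup

/-- The intermediate jacobian `J(V_x) = V_ℂ / (V_ℤ + F^0 V_ℂ)` of the fibre over `x`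
(meant for weight `-1`). -/
def Jacobian (V : VHS E X n k) (x : X) : Type _ := V.fiberC x ⧸ V.periods x

instance (V : VHS E X n k) (x : X) : AddCommGroup (V.Jacobian x) :=
  inferInstanceAs (AddCommGroup (V.fiberC x ⧸ V.periods x))

/-- The projection `V_ℂ → J(V_x)`. -/
def proj (V : VHS E X n k) (x : X) : V.fiberC x →+ V.Jacobian x :=
  QuotientAddGroup.mk' (V.periods x)

/-- `f` is a holomorphic lift over the open set `U ⊆ dom a` of the section `ν` of `J(𝕍)`. -/
structure IsHolomorphicLift (V : VHS E X n k) (ν : ∀ x, V.Jacobian x) (a : X) (U : Set X)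
    (f : ∀ y, V.fiberC y) : Prop where
  isOpen : IsOpen U
  subset_dom : U ⊆ V.dom a
  holomorphic : V.IsHolomorphicOn (E := E) a f U
  lifts : ∀ y ∈ U, V.proj y (f y) = ν y

/-- `ν` is a holomorphic section of `J(𝕍) = 𝒱 / (𝓕^0 + 𝕍_ℤ)`: it lifts locally to holomorphic
sections of `𝒱`. -/
def IsHolomorphicSection (V : VHS E X n k) (ν : ∀ x, V.Jacobian x) : Prop :=
  ∀ x, ∃ U f, x ∈ U ∧ V.IsHolomorphicLift ν x U f

/-- A section `ν` of `J(𝕍)` corresponds to an extension `0 → 𝕍 → 𝔼 → ℤ(0) → 0`. Over the domain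
of a lift `f` of `ν`, a flat lift of `1 ∈ ℤ` to `𝔼` identifies `𝔼 ⊗ 𝒪` with `𝒱 ⊕ 𝒪` as flat
bundles; this is the Hodge filtration of `𝔼` in these terms:
`F^p 𝔼 = F^p 𝕍` for `p > 0`, and `F^p 𝔼 = F^p 𝕍 + ℂ (f, 1)` for `p ≤ 0`. -/
def extF (V : VHS E X n k) (f : ∀ y, V.fiberC y) (p : ℤ) (y : X) :
    Submodule ℂ (V.fiberC y × ℂ) :=
  (V.F p y).map (LinearMap.inl ℂ (V.fiberC y) ℂ) ⊔
    (if p ≤ 0 then Submodule.span ℂ {(f y, (1 : ℂ))} else ⊥)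

/-- `ν` is a normal function: a holomorphic section of `J(𝕍)` for which the corresponding
extension `𝔼` of `ℤ(0)` by `𝕍` is a variation of mixed Hodge structure, i.e. for which the
Hodge filtration of `𝔼` satisfies Griffiths transversality
`∇ F^p 𝔼 ⊆ F^{p-1} 𝔼 ⊗ Ω¹` (the other axioms of a variation of mixed Hodge structure are
automatic for `𝔼`). A local section of `𝔼 ⊗ 𝒪` is a pair `(σ, h)` of a section of `𝒱` and a
function. No condition at infinity (admissibility) is imposed, so that admissible normal
functions are a special case. -/
structure IsNormalFunction (V : VHS E X n k) (ν : ∀ x, V.Jacobian x) : Prop where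
  holomorphic : V.IsHolomorphicSection ν
  transversal : ∀ (a : X) (U : Set X) (f : ∀ y, V.fiberC y), V.IsHolomorphicLift ν a U f →
    ∀ (p : ℤ) (W : Set X), IsOpen W → W ⊆ U →
    ∀ (σ : ∀ y, V.fiberC y) (h : X → ℂ), V.IsHolomorphicOn (E := E) a σ W →
      ContMDiffOn 𝓘(ℂ, E) 𝓘(ℂ, ℂ) ω h W →
      (∀ y ∈ W, (σ y, h y) ∈ V.extF f p y) →
      ∀ y ∈ W, ∀ u : TangentSpace 𝓘(ℂ, E) y,
        (V.nabla a σ y u, (mfderiv 𝓘(ℂ, E) 𝓘(ℂ, ℂ) h y u : ℂ)) ∈ V.extF f (p - 1) y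

/-! ### The parallel, translation-invariant form and its pull-back -/

/-- As a bundle of real tori `J(𝕍) = 𝕍_ℝ / 𝕍_ℤ` when the weight is `-1`. This is the flat chart
`dom a × ℝⁿ → J(𝕍)`, `(y, ξ) ↦ ∑ ξ_i e_i(y)`, where `e` is the flat frame over `dom a`. These
charts are the local diffeomorphisms (coverings of `J(𝕍)` over `dom a`) that define the
smooth structure and the flat structure of `J(𝕍)`. -/
def flatChart (V : VHS E X n k) (a : X) (p : X × (Fin n → ℝ)) : V.Jacobian p.1 :=
  V.proj p.1 (V.ofCoord a p.1 fun i => (p.2 i : ℂ))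

/-- The value at `y` of `S` on vectors given by coordinates in the flat frame over `dom a`. -/
def WeakPolarization.coordForm {V : VHS E X n k} (S : V.WeakPolarization) (a y : X)
    (ξ η : Fin n → ℝ) : ℝ :=
  ∑ i, ∑ j, ξ i * η j * S.form y (V.frame a y i) (V.frame a y j)

/-- The 2-form `ω_S` on `J(𝕍)` in the flat chart `dom a × ℝⁿ`: the parallel 2-form that vanishes
on the leaves `ξ = const`, and whose restriction to each fibre is the translation-invariant form
`S`. Thus `ω_S ((u, ξ), (w, η)) = S(ξ, η)`. -/
def WeakPolarization.omega {V : VHS E X n k} (S : V.WeakPolarization) (a : X)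
    (p : X × (Fin n → ℝ))
    (ξ η : TangentSpace (𝓘(ℝ, E).prod 𝓘(ℝ, Fin n → ℝ)) p) : ℝ :=
  S.coordForm a p.1 (Prod.snd (ξ : E × (Fin n → ℝ))) (Prod.snd (η : E × (Fin n → ℝ)))

/-- `y ↦ (y, c y)` is a smooth local lift over the open set `U ⊆ dom a` of the section `ν` through
the flat chart of `J(𝕍)`; equivalently `c` gives the flat coordinates of a smooth lift of `ν` to
a section of `𝕍_ℝ`. -/
structure IsFlatLift (V : VHS E X n k) (ν : ∀ x, V.Jacobian x) (a : X) (U : Set X)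
    (c : X → Fin n → ℝ) : Prop where
  isOpen : IsOpen U
  subset_dom : U ⊆ V.dom a
  smooth : ContMDiffOn 𝓘(ℝ, E) 𝓘(ℝ, Fin n → ℝ) ∞ c U
  lifts : ∀ y ∈ U, V.flatChart a (y, c y) = ν y

end VHS

/-! ### Differential 2-forms on a complex manifold -/

section Forms

variable (E : Type*) [NormedAddCommGroup E] [NormedSpace ℂ E]
  (X : Type*) [TopologicalSpace X] [ChartedSpace E X]

/-- Real alternating 2-forms on the real tangent spaces of `X`. -/
abbrev TwoForm : Type _ := ∀ x : X, (TangentSpace 𝓘(ℝ, E) x) [⋀^Fin 2]→L[ℝ] ℝ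

variable {E X}

/-- Smoothness of a 2-form: its coefficients in each chart of the manifold are smooth. -/
def TwoForm.IsSmooth (η : TwoForm E X) : Prop :=
  ∀ (x : X) (u w : E), ContDiffOn ℝ ∞
    (fun z : E => η ((extChartAt 𝓘(ℝ, E) x).symm z)
      ![mfderiv 𝓘(ℝ, E) 𝓘(ℝ, E) (extChartAt 𝓘(ℝ, E) x).symm z u,
        mfderiv 𝓘(ℝ, E) 𝓘(ℝ, E) (extChartAt 𝓘(ℝ, E) x).symm z w])
    (extChartAt 𝓘(ℝ, E) x).target

/-- The complex structure `J` of the tangent space, multiplication by `i`. -/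
def mulI {x : X} (u : TangentSpace 𝓘(ℝ, E) x) : TangentSpace 𝓘(ℝ, E) x :=
  let v : E := u
  (Complex.I • v : E)

/-- A real 2-form is of type `(1,1)` iff it is invariant under the complex structure. -/
def TwoForm.IsOneOne (η : TwoForm E X) : Prop :=
  ∀ (x : X) (u w : TangentSpace 𝓘(ℝ, E) x), η x ![mulI u, mulI w] = η x ![u, w]

/-- A real `(1,1)`-form is non-negative iff `η(u, J u) ≥ 0` for all `u`, i.e. iff in local
holomorphic coordinates it is `i ∑ h_{jk} dz_j ∧ dz̄_k` with `h` positive semi-definite. -/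
def TwoForm.IsNonneg (η : TwoForm E X) : Prop :=
  ∀ (x : X) (u : TangentSpace 𝓘(ℝ, E) x), 0 ≤ η x ![u, mulI u]

/-- `η = ν^* ω_S`: wherever `ν` is given, through a flat chart of `J(𝕍)`, by a smooth map
`Γ : y ↦ (y, c y)`, the form `η` is `Γ^* ω_S`. -/
def TwoForm.IsPullback {n : ℕ} {k : ℤ} {V : VHS E X n k} (S : V.WeakPolarization)
    (ν : ∀ x, V.Jacobian x) (η : TwoForm E X) : Prop :=
  ∀ (a : X) (U : Set X) (c : X → Fin n → ℝ), V.IsFlatLift ν a U c →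
    ∀ y ∈ U, ∀ u w : TangentSpace 𝓘(ℝ, E) y,
      η y ![u, w] = S.omega a (y, c y)
        (mfderiv 𝓘(ℝ, E) (𝓘(ℝ, E).prod 𝓘(ℝ, Fin n → ℝ)) (fun z => (z, c z)) y u)
        (mfderiv 𝓘(ℝ, E) (𝓘(ℝ, E).prod 𝓘(ℝ, Fin n → ℝ)) (fun z => (z, c z)) y w)

end Forms

end NormalFunction

end

/-! In weight -1, `V_ℂ = V_ℝ ⊕ F^0`, so a holomorphic lift `f` of `ν` splits as `f = c + s` with `c`
real and `s = ∑ φ_i g_i` in `F^0`. Here `g` is a holomorphic frame of `F^0`. The splitting varies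
smoothly, so `c` is a smooth flat lift and the pull-back is `S(dc, dc)`. Two flat lifts differ,
after the change of frame, by a continuous integral vector. This vector is locally constant, so the
pull-back is well defined (`coordForm_eq`).

Transversality for `𝔼` gives `∇f ∈ F^{-1}`, and transversality for `𝕍` gives `∇g_i ∈ F^{-1}`. Hence
`dc` is real with values in `F^{-1}`, that is, `dc(u) = α + conj α` with `α` of type `(-1,0)`. The
coefficients `φ_i` need not be holomorphic, but their derivatives only multiply vectors of `F^0`. So
`dc` is complex linear modulo `F^0` (`exists_isFlatLift`), and replacing `u` by `iu` replaces `α` by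
`iα` (`exists_hodgePart_I_smul`).

The rest is linear algebra. Orthogonality of types makes `S(dc, dc)` invariant under `α ↦ iα`, and
skew-symmetry gives `S(dc(u), dc(iu)) = 2 i^{-1} S(α, conj α) ≥ 0`. -/

namespace NormalFunction

/-! ### Real vectors and weak polarizations in weight -1 -/

section Linear

variable {M : Type*} [AddCommGroup M]

theorem conjC_conjC (v : ℂ ⊗[ℤ] M) : conjC M (conjC M v) = v := by
  induction v with
  | zero => simp
  | tmul z m => simp
  | add v w hv hw => simp only [map_add, hv, hw]

theorem mem_conjSubspace {W : Submodule ℂ (ℂ ⊗[ℤ] M)} {v : ℂ ⊗[ℤ] M} :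
    v ∈ conjSubspace W ↔ conjC M v ∈ W := Iff.rfl

variable {F : ℤ → Submodule ℂ (ℂ ⊗[ℤ] M)} {S : M →ₗ[ℤ] M →ₗ[ℤ] ℝ}

theorem conjC_mem_hodgePart {p q : ℤ} {v : ℂ ⊗[ℤ] M} (h : v ∈ hodgePart F p q) :
    conjC M v ∈ hodgePart F q p :=
  ⟨h.2, mem_conjSubspace.2 (by rw [conjC_conjC]; exact h.1)⟩

/-- In weight `-1` the space `F^0` contains no conjugate pair of nonzero vectors. -/
theorem IsHodgeFiltration.eq_zero (hF : IsHodgeFiltration (-1) F) {v : ℂ ⊗[ℤ] M}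
    (h : v ∈ F 0) (h' : conjC M v ∈ F 0) : v = 0 :=
  Submodule.disjoint_def.1 (hF.isCompl 0 0 (by norm_num)).disjoint v h h'

theorem IsHodgeFiltration.exists_add_conj (hF : IsHodgeFiltration (-1) F) (v : ℂ ⊗[ℤ] M) :
    ∃ a ∈ F 0, ∃ b ∈ F 0, v = a + conjC M b := by
  have h : v ∈ F 0 ⊔ conjSubspace (F 0) := by
    rw [(hF.isCompl 0 0 (by norm_num)).sup_eq_top]; trivial
  obtain ⟨a, ha, b, hb, rfl⟩ := Submodule.mem_sup.1 h
  exact ⟨a, ha, conjC M b, hb, by rw [conjC_conjC]⟩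

/-- A real vector of `F^{-1}` is the sum of a vector of type `(-1,0)` and its conjugate. -/
theorem IsHodgeFiltration.exists_hodgePart (hF : IsHodgeFiltration (-1) F) {d : ℂ ⊗[ℤ] M}
    (hd : d ∈ F (-1)) (hr : conjC M d = d) :
    ∃ α ∈ hodgePart F (-1) 0, d = α + conjC M α := by
  obtain ⟨a, ha, b, hb, rfl⟩ := hF.exists_add_conj d
  -- Reality of `d` reads `a + conj b = conj a + b`, so `a - b` is a real vector of `F^0`.
  have hab : a = b := by
    rw [map_add, conjC_conjC] at hr
    refine sub_eq_zero.1 (hF.eq_zero (sub_mem ha hb) ?_)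
    have : conjC M (a - b) = a - b := by
      rw [map_sub, sub_eq_sub_iff_add_eq_add, hr]
    rw [this]
    exact sub_mem ha hb
  subst hab
  -- The `(-1,0)`-part is `conj a = d - a`, which lies in `F^{-1}` because both `d` and `a` do.
  refine ⟨conjC M a, ⟨?_, ?_⟩, ?_⟩
  · have := sub_mem hd (hF.antitone (by norm_num : (-1 : ℤ) ≤ 0) ha)
    rwa [add_sub_cancel_left] at this
  · exact mem_conjSubspace.2 (by rwa [conjC_conjC])
  · rw [conjC_conjC, add_comm]

theorem complexify_skew (h : ∀ u v, S u v = -S v u) (v w : ℂ ⊗[ℤ] M) :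
    complexify S v w = -complexify S w v := by
  induction v with
  | zero => simp
  | add v v' hv hv' => simp only [map_add, LinearMap.add_apply, hv, hv', neg_add]
  | tmul z m =>
    induction w with
    | zero => simp
    | add w w' hw hw' => simp only [map_add, LinearMap.add_apply, hw, hw', neg_add]
    | tmul z' m' =>
      rw [complexify_tmul, complexify_tmul, h m m']
      push_cast
      ring

theorem IsWeakPolarization.skew (hS : IsWeakPolarization (-1) F S) (u v : M) :
    S u v = -S v u := by
  rw [hS.symm u v]; norm_num

/-- Orthogonality pairs a type only with its conjugate type, so the `(-1,0)`-`(-1,0)` and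
`(0,-1)`-`(0,-1)` terms vanish. -/
theorem IsWeakPolarization.complexify_add_conj (hS : IsWeakPolarization (-1) F S)
    {α β : ℂ ⊗[ℤ] M} (hα : α ∈ hodgePart F (-1) 0) (hβ : β ∈ hodgePart F (-1) 0) :
    complexify S (α + conjC M α) (β + conjC M β) =
      complexify S α (conjC M β) + complexify S (conjC M α) β := by
  have h1 : complexify S α β = 0 := by
    have := hS.orthogonal (-1) 0 0 (-1) (by norm_num) (by norm_num) (by simp) α hα _
      (conjC_mem_hodgePart hβ)
    rwa [conjC_conjC] at this
  have h2 : complexify S (conjC M α) (conjC M β) = 0 :=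
    hS.orthogonal 0 (-1) (-1) 0 (by norm_num) (by norm_num) (by simp) _
      (conjC_mem_hodgePart hα) β hβ
  simp only [map_add, LinearMap.add_apply, h1, h2]
  ring

/-- In each surviving term one argument acquires the factor `i` and the other `-i`, and these
cancel. -/
theorem IsWeakPolarization.complexify_I_smul (hS : IsWeakPolarization (-1) F S)
    {α β : ℂ ⊗[ℤ] M} (hα : α ∈ hodgePart F (-1) 0) (hβ : β ∈ hodgePart F (-1) 0) :
    complexify S (Complex.I • α + conjC M (Complex.I • α))
        (Complex.I • β + conjC M (Complex.I • β)) =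
      complexify S (α + conjC M α) (β + conjC M β) := by
  rw [hS.complexify_add_conj (Submodule.smul_mem _ _ hα) (Submodule.smul_mem _ _ hβ),
    hS.complexify_add_conj hα hβ]
  simp only [map_smulₛₗ, LinearMap.smul_apply, Complex.conj_I, smul_eq_mul, RingHom.id_apply]
  linear_combination (-complexify S α (conjC M β) - complexify S (conjC M α) β) * Complex.I_sq

/-- The surviving terms are `-i S(α, conj α)` and `i S(conj α, α)`. They are equal by skew-symmetry,
and `-i = i^{p-q}` for type `(-1,0)`. -/
theorem IsWeakPolarization.complexify_I_smul_nonneg (hS : IsWeakPolarization (-1) F S)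
    {α : ℂ ⊗[ℤ] M} (hα : α ∈ hodgePart F (-1) 0) :
    0 ≤ complexify S (α + conjC M α) (Complex.I • α + conjC M (Complex.I • α)) := by
  rw [hS.complexify_add_conj hα (Submodule.smul_mem _ _ hα)]
  have h := hS.nonneg (-1) 0 (by norm_num) α hα
  have h2 := add_nonneg h h
  convert h2 using 1
  rw [show ((-1 : ℤ) - 0) = -1 by norm_num, zpow_neg_one, Complex.inv_I]
  simp only [map_smulₛₗ, Complex.conj_I, smul_eq_mul, RingHom.id_apply]
  rw [complexify_skew hS.skew (conjC M α) α]
  ring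

/-- The decomposition used for the differential of a normal function: if two real vectors `d`, `e`
of `F^{-1}` satisfy `e ≡ i d` modulo `F^0`, then their `(-1,0)`-components are `α` and `i α`. -/
theorem IsHodgeFiltration.exists_hodgePart_I_smul (hF : IsHodgeFiltration (-1) F)
    {d e : ℂ ⊗[ℤ] M} (hd : d ∈ F (-1)) (he : e ∈ F (-1)) (hdr : conjC M d = d)
    (her : conjC M e = e) (h : e - Complex.I • d ∈ F 0) :
    ∃ α ∈ hodgePart F (-1) 0, d = α + conjC M α ∧
      e = Complex.I • α + conjC M (Complex.I • α) := by
  obtain ⟨α, hα, rfl⟩ := hF.exists_hodgePart hd hdr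
  obtain ⟨β, hβ, rfl⟩ := hF.exists_hodgePart he her
  refine ⟨α, hα, rfl, ?_⟩
  have hα' : conjC M α ∈ F 0 := hα.2
  have hβ' : conjC M β ∈ F 0 := hβ.2
  -- Both `β - iα` and its conjugate lie in `F^0`: the former equals `e - i d` up to the vectors
  -- `conj α`, `conj β` of `F^0`.
  have key : β = Complex.I • α := by
    refine sub_eq_zero.1 (hF.eq_zero ?_ ?_)
    · have : β - Complex.I • α = (β + conjC M β - Complex.I • (α + conjC M α)) -
          (conjC M β - Complex.I • conjC M α) := by rw [smul_add]; abel
      rw [this]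
      exact sub_mem h (sub_mem hβ' (Submodule.smul_mem _ _ hα'))
    · rw [map_sub, map_smulₛₗ]
      exact sub_mem hβ' (Submodule.smul_mem _ _ hα')
  rw [key]

end Linear

/-! ### Flat coordinates and real vectors -/

namespace LocalSystem

variable {X : Type*} [TopologicalSpace X] {n : ℕ} (L : LocalSystem X n)

theorem ofCoord_eq_sum (a y : X) (c : Fin n → ℂ) :
    L.ofCoord a y c = ∑ i, c i • ((1 : ℂ) ⊗ₜ[ℤ] L.frame a y i) := by
  simp [ofCoord, frameC, Module.Basis.equivFun_symm_apply]

theorem ofCoord_injective (a y : X) : Function.Injective (L.ofCoord a y) :=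
  (L.frameC a y).equivFun.symm.injective

theorem ofCoord_add (a y : X) (c d : Fin n → ℂ) :
    L.ofCoord a y (c + d) = L.ofCoord a y c + L.ofCoord a y d :=
  map_add (L.frameC a y).equivFun.symm c d

theorem ofCoord_sub (a y : X) (c d : Fin n → ℂ) :
    L.ofCoord a y (c - d) = L.ofCoord a y c - L.ofCoord a y d :=
  map_sub (L.frameC a y).equivFun.symm c d

theorem ofCoord_smul (a y : X) (z : ℂ) (c : Fin n → ℂ) :
    L.ofCoord a y (z • c) = z • L.ofCoord a y c :=
  map_smul (L.frameC a y).equivFun.symm z c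

theorem ofCoord_sum {ι : Type*} (a y : X) (s : Finset ι) (c : ι → Fin n → ℂ) :
    L.ofCoord a y (∑ i ∈ s, c i) = ∑ i ∈ s, L.ofCoord a y (c i) :=
  map_sum (L.frameC a y).equivFun.symm c s

theorem ofCoord_coord (a y : X) (σ : ∀ y, L.fiberC y) : L.ofCoord a y (L.coord a σ y) = σ y :=
  (L.frameC a y).equivFun.symm_apply_apply (σ y)

theorem conjC_ofCoord (a y : X) (c : Fin n → ℂ) :
    conjC _ (L.ofCoord a y c) = L.ofCoord a y (fun i => starRingEnd ℂ (c i)) := by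
  simp [ofCoord_eq_sum, map_sum]

/-- The inclusion of `ℝⁿ` in `ℂⁿ`. -/
noncomputable def toComplex (n : ℕ) : (Fin n → ℝ) →L[ℝ] (Fin n → ℂ) :=
  ContinuousLinearMap.pi fun i => Complex.ofRealCLM ∘L ContinuousLinearMap.proj i

@[simp] theorem toComplex_apply (ξ : Fin n → ℝ) (i : Fin n) : toComplex n ξ i = (ξ i : ℂ) := rfl

theorem toComplex_injective : Function.Injective (toComplex n) := fun ξ η h => by
  funext i
  exact Complex.ofReal_injective (congrFun h i)

theorem conjC_ofCoord_toComplex (a y : X) (ξ : Fin n → ℝ) :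
    conjC _ (L.ofCoord a y (toComplex n ξ)) = L.ofCoord a y (toComplex n ξ) := by
  rw [conjC_ofCoord]
  congr 1
  funext i
  simp

/-- A vector fixed by conjugation has real coordinates. -/
theorem exists_ofCoord_toComplex (a y : X) {v : L.fiberC y} (hv : conjC _ v = v) :
    ∃ ξ : Fin n → ℝ, v = L.ofCoord a y (toComplex n ξ) := by
  obtain ⟨c, rfl⟩ : ∃ c, L.ofCoord a y c = v := (L.frameC a y).equivFun.symm.surjective v
  rw [conjC_ofCoord] at hv
  have h := L.ofCoord_injective a y hv
  refine ⟨fun i => (c i).re, congrArg _ ?_⟩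
  funext i
  exact (Complex.conj_eq_iff_re.1 (congrFun h i)).symm

/-- Real vectors with coordinates `ξ` in one flat frame have coordinates `T ξ` in another, where
`T` is the transition matrix. -/
theorem ofCoord_toComplex_transition (a b y : X) (ξ : Fin n → ℝ) :
    L.ofCoord b y (toComplex n ξ) = L.ofCoord a y (toComplex n
      ((((L.frame a y).toMatrix (L.frame b y)).map (Int.cast : ℤ → ℝ)).mulVec ξ)) := by
  simp only [ofCoord_eq_sum, toComplex_apply, Matrix.mulVec, dotProduct, Matrix.map_apply]
  have h (j : Fin n) : L.frame b y j = ∑ i, (L.frame a y).toMatrix (L.frame b y) i j •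
      L.frame a y i := ((L.frame a y).sum_toMatrix_smul_self (L.frame b y) j).symm
  conv_lhs =>
    enter [2, j]
    rw [h j]
  simp only [TensorProduct.tmul_sum, Finset.smul_sum, Complex.ofReal_sum, Finset.sum_smul]
  rw [Finset.sum_comm]
  refine Finset.sum_congr rfl fun i _ => Finset.sum_congr rfl fun j _ => ?_
  rw [TensorProduct.tmul_smul, ← Int.cast_smul_eq_zsmul ℂ, smul_smul]
  push_cast
  rw [mul_comm]

end LocalSystem

/-! ### The polarization in flat coordinates and the period lattice -/

namespace VHS

open LocalSystem

variable {E : Type*} [NormedAddCommGroup E] [NormedSpace ℂ E]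
  {X : Type*} [TopologicalSpace X] [ChartedSpace E X] {n : ℕ}

/-- Carries the Hodge-theoretic relations for the complexified form over to real flat coordinates.
-/
theorem WeakPolarization.ofReal_coordForm {k : ℤ} {V : VHS E X n k} (S : V.WeakPolarization)
    (a y : X) (ξ η : Fin n → ℝ) :
    (S.coordForm a y ξ η : ℂ) = complexify (S.form y) (V.ofCoord a y (toComplex n ξ))
      (V.ofCoord a y (toComplex n η)) := by
  simp only [coordForm, ofCoord_eq_sum, map_sum, LinearMap.sum_apply, map_smul,
    LinearMap.smul_apply, complexify_tmul, toComplex_apply, smul_eq_mul]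
  push_cast
  simp only [Finset.mul_sum]
  refine Finset.sum_comm.trans (Finset.sum_congr rfl fun i _ => Finset.sum_congr rfl fun j _ => ?_)
  ring

theorem WeakPolarization.coordForm_transition {k : ℤ} {V : VHS E X n k} (S : V.WeakPolarization)
    (a b y : X) (ξ η : Fin n → ℝ) :
    S.coordForm b y ξ η = S.coordForm a y
      ((((V.frame a y).toMatrix (V.frame b y)).map (Int.cast : ℤ → ℝ)).mulVec ξ)
      ((((V.frame a y).toMatrix (V.frame b y)).map (Int.cast : ℤ → ℝ)).mulVec η) := by
  apply Complex.ofReal_injective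
  rw [S.ofReal_coordForm, S.ofReal_coordForm, V.ofCoord_toComplex_transition a b,
    V.ofCoord_toComplex_transition a b]

theorem WeakPolarization.coordForm_skew {V : VHS E X n (-1)} (S : V.WeakPolarization)
    (a y : X) (ξ η : Fin n → ℝ) : S.coordForm a y ξ η = -S.coordForm a y η ξ := by
  apply Complex.ofReal_injective
  rw [Complex.ofReal_neg, S.ofReal_coordForm, S.ofReal_coordForm]
  exact complexify_skew (S.isWeakPolarization y).skew _ _

theorem WeakPolarization.coordForm_self {V : VHS E X n (-1)} (S : V.WeakPolarization)
    (a y : X) (ξ : Fin n → ℝ) : S.coordForm a y ξ ξ = 0 := by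
  have := S.coordForm_skew a y ξ ξ
  linarith

/-- The form `coordForm` at `y`, as a continuous bilinear form. -/
noncomputable def WeakPolarization.coordFormCLM {k : ℤ} {V : VHS E X n k} (S : V.WeakPolarization)
    (a y : X) : (Fin n → ℝ) →L[ℝ] (Fin n → ℝ) →L[ℝ] ℝ :=
  ∑ i, ∑ j, (S.form y (V.frame a y i) (V.frame a y j)) •
    (ContinuousLinearMap.proj (R := ℝ) (φ := fun _ : Fin n => ℝ) i).smulRight
      (ContinuousLinearMap.proj (R := ℝ) (φ := fun _ : Fin n => ℝ) j)

theorem WeakPolarization.coordFormCLM_apply {k : ℤ} {V : VHS E X n k} (S : V.WeakPolarization)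
    (a y : X) (ξ η : Fin n → ℝ) : S.coordFormCLM a y ξ η = S.coordForm a y ξ η := by
  simp only [coordFormCLM, coordForm, _root_.sum_apply,
    _root_.smul_apply, ContinuousLinearMap.smulRight_apply,
    ContinuousLinearMap.proj_apply, smul_eq_mul]
  refine Finset.sum_congr rfl fun i _ => Finset.sum_congr rfl fun j _ => ?_
  ring

theorem proj_eq_proj_iff {k : ℤ} (V : VHS E X n k) (x : X) (v w : V.fiberC x) :
    V.proj x v = V.proj x w ↔ v - w ∈ V.periods x := by
  rw [← sub_eq_zero, ← map_sub]
  exact QuotientAddGroup.eq_zero_iff (v - w)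

/-- The lattice of `J(V_x) = V_ℝ / V_ℤ`: a real vector is a period iff it is integral. -/
theorem exists_int_of_mem_periods (V : VHS E X n (-1)) (a x : X) (ξ : Fin n → ℝ)
    (h : V.ofCoord a x (toComplex n ξ) ∈ V.periods x) : ∃ m : Fin n → ℤ, ∀ i, ξ i = m i := by
  obtain ⟨_, ⟨m, rfl⟩, w, hw, hmw⟩ := AddSubgroup.mem_sup.1 h
  change (1 : ℂ) ⊗ₜ[ℤ] m + w = _ at hmw
  have hm : (1 : ℂ) ⊗ₜ[ℤ] m = V.ofCoord a x (toComplex n fun i => ((V.frame a x).repr m i : ℝ)) := by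
    conv_lhs => rw [← (V.frame a x).sum_repr m]
    rw [ofCoord_eq_sum, TensorProduct.tmul_sum]
    refine Finset.sum_congr rfl fun i _ => ?_
    rw [TensorProduct.tmul_smul, ← Int.cast_smul_eq_zsmul ℂ]
    simp
  -- The `F^0`-part of the period is a difference of two real vectors, hence real, hence zero.
  have hw' : conjC _ w = w := by
    rw [← eq_sub_iff_add_eq'] at hmw
    rw [hmw, map_sub, conjC_ofCoord_toComplex, conjC_tmul, map_one]
  have hw0 : w = 0 := (V.isHodge x).eq_zero hw (by rw [hw']; exact hw)
  rw [hw0, add_zero, hm] at hmw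
  exact ⟨fun i => (V.frame a x).repr m i, fun i =>
    (congrFun (toComplex_injective (V.ofCoord_injective a x hmw)) i).symm⟩

end VHS

/-! ### Real smoothness and derivatives of holomorphic maps -/

section Scalars

variable {E : Type*} [NormedAddCommGroup E] [NormedSpace ℂ E]
  {X : Type*} [TopologicalSpace X] [ChartedSpace E X]
  {G : Type*} [NormedAddCommGroup G] [NormedSpace ℂ G]

/-- Holomorphic maps are smooth over the reals. -/
theorem contMDiffOn_real {f : X → G} {U : Set X} (h : ContMDiffOn 𝓘(ℂ, E) 𝓘(ℂ, G) ω f U) :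
    ContMDiffOn 𝓘(ℝ, E) 𝓘(ℝ, G) ∞ f U := by
  intro x hx
  obtain ⟨h1, h2⟩ := contMDiffWithinAt_iff.1 (h x hx)
  exact contMDiffWithinAt_iff.2 ⟨h1, (h2.restrict_scalars ℝ).of_le le_top⟩

/-- A complex manifold is a smooth real manifold. -/
theorem isManifold_real [IsManifold 𝓘(ℂ, E) ω X] : IsManifold 𝓘(ℝ, E) ∞ X := by
  refine isManifold_of_contDiffOn _ _ _ fun e e' he he' => ?_
  have h := (mem_groupoid_of_pregroupoid.1
    (HasGroupoid.compatible (G := contDiffGroupoid ω 𝓘(ℂ, E)) he he')).1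
  exact (h.restrict_scalars ℝ).of_le le_top

/-- Over either field the derivative is that of the same map read in the same chart, so real and
complex derivatives can be compared there. -/
theorem hasMFDerivAt_iff_chartAt {𝕜 : Type*} [NontriviallyNormedField 𝕜] {E G X : Type*}
    [NormedAddCommGroup E] [NormedSpace 𝕜 E] [NormedAddCommGroup G] [NormedSpace 𝕜 G]
    [TopologicalSpace X] [ChartedSpace E X] {f : X → G} {x : X} {f' : E →L[𝕜] G} :
    HasMFDerivAt 𝓘(𝕜, E) 𝓘(𝕜, G) f x f' ↔
      ContinuousAt f x ∧ HasFDerivAt (f ∘ (chartAt E x).symm) f' (chartAt E x x) := by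
  refine and_congr Iff.rfl ?_
  rw [← hasFDerivWithinAt_univ, ← 𝓘(𝕜, E).range_eq_univ]
  rfl

theorem hasFDerivAt_chartAt_real {f : X → G} {U : Set X}
    (h : ContMDiffOn 𝓘(ℂ, E) 𝓘(ℂ, G) ω f U) {x : X} (hU : U ∈ 𝓝 x) :
    HasFDerivAt (f ∘ (chartAt E x).symm)
      ((mfderiv 𝓘(ℂ, E) 𝓘(ℂ, G) f x : E →L[ℂ] G).restrictScalars ℝ) (chartAt E x x) :=
  (hasMFDerivAt_iff_chartAt.1
    ((h.contMDiffAt hU).mdifferentiableAt (by simp)).hasMFDerivAt).2.restrictScalars ℝ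

end Scalars

/-! ### The real lift of a normal function and its differential -/

namespace VHS

open LocalSystem

variable {E : Type*} [NormedAddCommGroup E] [NormedSpace ℂ E]
  {X : Type*} [TopologicalSpace X] [ChartedSpace E X] {n : ℕ}

/-- The second coordinate is the coefficient of `(f, 1)`, so its vanishing leaves only the part from
`F^p 𝕍`. -/
theorem mem_of_mem_extF_zero {k : ℤ} (V : VHS E X n k) {f : ∀ y, V.fiberC y} {p : ℤ} {y : X}
    {v : V.fiberC y} {t : ℂ} (h : (v, t) ∈ V.extF f p y) (ht : t = 0) : v ∈ V.F p y := by
  subst ht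
  obtain ⟨_, ⟨w, hw, rfl⟩, z, hz, hwz⟩ := Submodule.mem_sup.1 h
  have h1 := congrArg Prod.fst hwz
  have h2 := congrArg Prod.snd hwz
  have hz0 : z.1 = 0 := by
    split_ifs at hz
    · obtain ⟨t, rfl⟩ := Submodule.mem_span_singleton.1 hz
      have : t = 0 := by simpa using h2
      simp [this]
    · simp [(Submodule.mem_bot ℂ).1 hz]
  have : w = v := by simpa [hz0] using h1
  exact this ▸ hw

/-- Transversality for a normal function: a holomorphic lift `f` satisfies `∇ f ∈ F^{-1}`. -/
theorem IsNormalFunction.nabla_mem {k : ℤ} {V : VHS E X n k} {ν : ∀ x, V.Jacobian x}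
    (hν : V.IsNormalFunction ν) {a : X} {U : Set X} {f : ∀ y, V.fiberC y}
    (hf : V.IsHolomorphicLift ν a U f) {y : X} (hy : y ∈ U) (u : TangentSpace 𝓘(ℂ, E) y) :
    V.nabla a f y u ∈ V.F (-1) y := by
  -- The tautological section `(f, 1)` of `F^0 𝔼` has derivative `(∇f, 0)`.
  have h := hν.transversal a U f hf 0 U hf.isOpen le_rfl f (fun _ => 1) hf.holomorphic
    contMDiffOn_const (fun z _ => by
      rw [extF, if_pos le_rfl]
      exact Submodule.mem_sup_right (Submodule.mem_span_singleton_self _)) y hy u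
  refine V.mem_of_mem_extF_zero (t := (mfderiv 𝓘(ℂ, E) 𝓘(ℂ, ℂ) (fun _ => (1 : ℂ)) y u : ℂ)) h ?_
  rw [mfderiv_const]
  rfl

/-- The real linear map `ℝⁿ × ℂʳ → ℂⁿ`, `(ξ, φ) ↦ ξ + ∑ φ_i g_i`. -/
noncomputable def realAddSpan {r : ℕ} (g : Fin r → Fin n → ℂ) :
    ((Fin n → ℝ) × (Fin r → ℂ)) →L[ℝ] (Fin n → ℂ) :=
  toComplex n ∘L ContinuousLinearMap.fst ℝ (Fin n → ℝ) (Fin r → ℂ) +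
    ∑ i, ((ContinuousLinearMap.lsmul ℝ ℂ).flip (g i)) ∘L
      (ContinuousLinearMap.proj (R := ℝ) (φ := fun _ : Fin r => ℂ) i ∘L
        ContinuousLinearMap.snd ℝ (Fin n → ℝ) (Fin r → ℂ))

theorem realAddSpan_apply {r : ℕ} (g : Fin r → Fin n → ℂ) (p : (Fin n → ℝ) × (Fin r → ℂ)) :
    realAddSpan g p = toComplex n p.1 + ∑ i, p.2 i • g i := by
  simp [realAddSpan, _root_.sum_apply]

theorem contMDiffOn_realAddSpan {r : ℕ} {g : Fin r → X → Fin n → ℂ} {U : Set X}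
    (hg : ∀ i, ContMDiffOn 𝓘(ℝ, E) 𝓘(ℝ, Fin n → ℂ) ∞ (g i) U) :
    ContMDiffOn 𝓘(ℝ, E) 𝓘(ℝ, ((Fin n → ℝ) × (Fin r → ℂ)) →L[ℝ] (Fin n → ℂ)) ∞
      (fun y => realAddSpan fun i => g i y) U := by
  unfold realAddSpan
  refine contMDiffOn_const.add (contMDiffOn_finsetSum fun i _ => ?_)
  refine ContMDiffOn.clm_comp ?_ contMDiffOn_const
  exact (ContinuousLinearMap.contMDiff (L := (ContinuousLinearMap.lsmul ℝ ℂ).flip)).comp_contMDiffOn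
    (hg i)

/-- This is `V_ℂ = V_ℝ ⊕ F^0`. A real vector of `F^0` is zero, and `a + conj b = (b + conj b) + (a -
b)` for `a`, `b` in `F^0`. -/
theorem realAddSpan_bijective (V : VHS E X n (-1)) (a y : X) {r : ℕ} {g : Fin r → V.fiberC y}
    (hg : LinearIndependent ℂ g) (hs : Submodule.span ℂ (Set.range g) = V.F 0 y) :
    Function.Bijective (realAddSpan fun i => (V.frameC a y).equivFun (g i)) := by
  have key (p : (Fin n → ℝ) × (Fin r → ℂ)) :
      V.ofCoord a y (realAddSpan (fun i => (V.frameC a y).equivFun (g i)) p) =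
        V.ofCoord a y (toComplex n p.1) + ∑ i, p.2 i • g i := by
    rw [realAddSpan_apply, ofCoord_add, ofCoord_sum]
    congr 1
    refine Finset.sum_congr rfl fun i _ => ?_
    rw [ofCoord_smul]
    exact congrArg _ ((V.frameC a y).equivFun.symm_apply_apply (g i))
  have hmem (φ : Fin r → ℂ) : ∑ i, φ i • g i ∈ V.F 0 y := by
    rw [← hs]
    exact Submodule.sum_mem _ fun i _ => Submodule.smul_mem _ _ (Submodule.subset_span ⟨i, rfl⟩)
  constructor
  · rw [injective_iff_map_eq_zero]
    intro p hp
    have h := key p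
    rw [hp, show V.ofCoord a y 0 = 0 from map_zero (V.frameC a y).equivFun.symm] at h
    have h0 : V.ofCoord a y (toComplex n p.1) = 0 := by
      have hF : V.ofCoord a y (toComplex n p.1) ∈ V.F 0 y := by
        rw [eq_neg_of_add_eq_zero_left h.symm]
        exact neg_mem (hmem _)
      exact (V.isHodge y).eq_zero hF (by rw [conjC_ofCoord_toComplex]; exact hF)
    rw [h0, zero_add] at h
    refine Prod.ext ?_ (funext (Fintype.linearIndependent_iff.1 hg _ h.symm))
    refine toComplex_injective (V.ofCoord_injective a y ?_)
    rw [h0, Prod.fst_zero, map_zero]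
    exact (map_zero (V.frameC a y).equivFun.symm).symm
  · intro c
    obtain ⟨s, hs', b, hb, hsb⟩ := (V.isHodge y).exists_add_conj (V.ofCoord a y c)
    obtain ⟨ξ, hξ⟩ := V.exists_ofCoord_toComplex a y (v := b + conjC _ b)
      (by rw [map_add, conjC_conjC, add_comm])
    have hsub : s - b ∈ Submodule.span ℂ (Set.range g) := by rw [hs]; exact sub_mem hs' hb
    obtain ⟨φ, hφ⟩ := (Submodule.mem_span_range_iff_exists_fun ℂ).1 hsub
    refine ⟨(ξ, φ), V.ofCoord_injective a y ?_⟩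
    rw [key, hsb, ← hξ, hφ]
    abel

/-- Near each point a normal function has a smooth lift with real flat coordinates `c`. Its
differential takes values in `F^{-1}` and is complex linear modulo `F^0`. -/
theorem IsNormalFunction.exists_isFlatLift {V : VHS E X n (-1)} {ν : ∀ x, V.Jacobian x}
    (hν : V.IsNormalFunction ν) (x : X) :
    ∃ (U : Set X) (c : X → Fin n → ℝ) (D : E →L[ℝ] (Fin n → ℝ)), x ∈ U ∧ V.IsFlatLift ν x U c ∧
      HasMFDerivAt 𝓘(ℝ, E) 𝓘(ℝ, Fin n → ℝ) c x D ∧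
      ∀ u : E, V.ofCoord x x (toComplex n (D u)) ∈ V.F (-1) x ∧
        V.ofCoord x x (toComplex n (D (Complex.I • u))) -
          Complex.I • V.ofCoord x x (toComplex n (D u)) ∈ V.F 0 x := by
  obtain ⟨U₁, f, hx₁, hf⟩ := hν.holomorphic x
  obtain ⟨U₂, hU₂, hx₂, hd₂, r, g, hg, hgs⟩ := V.holomorphic 0 x
  set U := U₁ ∩ U₂ with hU
  have hUo : IsOpen U := hf.isOpen.inter hU₂
  have hxU : x ∈ U := ⟨hx₁, hx₂⟩
  have hfU : ContMDiffOn 𝓘(ℂ, E) 𝓘(ℂ, Fin n → ℂ) ω (V.coord x f) U :=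
    hf.holomorphic.mono Set.inter_subset_left
  have hgU (i) : ContMDiffOn 𝓘(ℂ, E) 𝓘(ℂ, Fin n → ℂ) ω (V.coord x (g i)) U :=
    (hg i).mono Set.inter_subset_right
  set A := fun y => realAddSpan (fun i => V.coord x (g i) y) with hA
  have hAb (y) (hy : y ∈ U) : Function.Bijective (A y) :=
    V.realAddSpan_bijective x y (hgs y hy.2).1 (hgs y hy.2).2
  have hAe (y) (hy : y ∈ U) : ∃ e : ((Fin n → ℝ) × (Fin r → ℂ)) ≃L[ℝ] (Fin n → ℂ), A y = e :=
    ⟨ContinuousLinearEquiv.ofBijective (A y) (LinearMap.ker_eq_bot.2 (hAb y hy).1)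
      (LinearMap.range_eq_top.2 (hAb y hy).2), rfl⟩
  -- `s` collects the real coordinates and the `F^0`-coefficients of `f`. Inversion is smooth at
  -- invertible operators; the default value 0 of `inverse` plays no role on `U`.
  set s := fun y => (A y).inverse (V.coord x f y) with hs
  have hAs (y) (hy : y ∈ U) : A y (s y) = V.coord x f y := by
    obtain ⟨e, he⟩ := hAe y hy
    simp only [hs, he, ContinuousLinearMap.inverse_equiv]
    exact e.apply_symm_apply _
  have hsU : ContMDiffOn 𝓘(ℝ, E) 𝓘(ℝ, (Fin n → ℝ) × (Fin r → ℂ)) ∞ s U := by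
    refine ContMDiffOn.clm_apply (fun y hy => ?_) (contMDiffOn_real hfU)
    obtain ⟨e, he⟩ := hAe y hy
    have h1 : ContDiffAt ℝ ∞ ContinuousLinearMap.inverse (A y) := by
      rw [he]; exact contDiffAt_map_inverse e
    exact h1.contMDiffAt.comp_contMDiffWithinAt y
      (contMDiffOn_realAddSpan (fun i => contMDiffOn_real (hgU i)) y hy)
  have hc : ContMDiffOn 𝓘(ℝ, E) 𝓘(ℝ, Fin n → ℝ) ∞ (fun y => (s y).1) U :=
    (ContinuousLinearMap.contMDiff
      (L := ContinuousLinearMap.fst ℝ (Fin n → ℝ) (Fin r → ℂ))).comp_contMDiffOn hsU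
  have hdecomp (y) (hy : y ∈ U) : f y = V.ofCoord x y (toComplex n (s y).1) +
      ∑ i, (s y).2 i • g i y := by
    rw [← V.ofCoord_coord x y f, ← hAs y hy, hA, realAddSpan_apply, ofCoord_add, ofCoord_sum]
    simp only [ofCoord_smul, ofCoord_coord]
  have hgF (y) (hy : y ∈ U) (i) : g i y ∈ V.F 0 y := by
    rw [← (hgs y hy.2).2]; exact Submodule.subset_span ⟨i, rfl⟩
  have hlift : V.IsFlatLift ν x U fun y => (s y).1 := by
    refine ⟨hUo, Set.inter_subset_left.trans hf.subset_dom, hc, fun y hy => ?_⟩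
    rw [← hf.lifts y hy.1]
    refine (V.proj_eq_proj_iff y _ _).2 (AddSubgroup.mem_sup_right ?_)
    change V.ofCoord x y (toComplex n (s y).1) - f y ∈ V.F 0 y
    rw [hdecomp y hy, sub_add_cancel_left]
    exact neg_mem (Submodule.sum_mem _ fun i _ => Submodule.smul_mem _ _ (hgF y hy i))
  have hUn : U ∈ 𝓝 x := hUo.mem_nhds hxU
  obtain ⟨Ds, hsd⟩ : ∃ D : E →L[ℝ] ((Fin n → ℝ) × (Fin r → ℂ)),
      HasFDerivAt (s ∘ (chartAt E x).symm) D (chartAt E x x) :=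
    ⟨_, (hasMFDerivAt_iff_chartAt.1
      ((hsU.contMDiffAt hUn).mdifferentiableAt (by simp)).hasMFDerivAt).2⟩
  obtain ⟨Dc, hDc⟩ : ∃ D : E →L[ℝ] (Fin n → ℝ),
      HasMFDerivAt 𝓘(ℝ, E) 𝓘(ℝ, Fin n → ℝ) (fun y => (s y).1) x D :=
    ⟨_, ((hc.contMDiffAt hUn).mdifferentiableAt (by simp)).hasMFDerivAt⟩
  have hcd := (hasMFDerivAt_iff_chartAt.1 hDc).2
  refine ⟨U, fun y => (s y).1, Dc, hxU, hlift, hDc, ?_⟩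
  obtain ⟨Df, hfd, hDfF⟩ : ∃ D : E →L[ℂ] (Fin n → ℂ),
      HasFDerivAt (V.coord x f ∘ (chartAt E x).symm) (D.restrictScalars ℝ) (chartAt E x x) ∧
      ∀ u, V.ofCoord x x (D u) ∈ V.F (-1) x :=
    ⟨_, hasFDerivAt_chartAt_real hfU hUn, fun u => hν.nabla_mem hf hx₁ u⟩
  have hDg (i) : ∃ D : E →L[ℂ] (Fin n → ℂ),
      HasFDerivAt (V.coord x (g i) ∘ (chartAt E x).symm) (D.restrictScalars ℝ) (chartAt E x x) ∧
      ∀ u, V.ofCoord x x (D u) ∈ V.F (-1) x :=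
    ⟨_, hasFDerivAt_chartAt_real (hgU i) hUn, fun u => V.transversal 0 x U₂ hU₂ hd₂ (g i) (hg i)
      (fun y hy => by rw [← (hgs y hy).2]; exact Submodule.subset_span ⟨i, rfl⟩) x hx₂ u⟩
  choose Dg hgd hDgF using hDg
  have hφd (i) : HasFDerivAt (fun z => (s ((chartAt E x).symm z)).2 i)
      ((ContinuousLinearMap.proj (R := ℝ) (φ := fun _ : Fin r => ℂ) i ∘L
        ContinuousLinearMap.snd ℝ (Fin n → ℝ) (Fin r → ℂ)) ∘L Ds) (chartAt E x x) :=
    (ContinuousLinearMap.hasFDerivAt (ContinuousLinearMap.proj (R := ℝ)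
      (φ := fun _ : Fin r => ℂ) i ∘L ContinuousLinearMap.snd ℝ (Fin n → ℝ) (Fin r → ℂ))).comp _ hsd
  have hx0 : (chartAt E x).symm (chartAt E x x) = x :=
    (chartAt E x).left_inv (mem_chart_source E x)
  have hev : ∀ᶠ z in 𝓝 (chartAt E x x), (chartAt E x).symm z ∈ U := by
    have := (chartAt E x).continuousAt_symm (mem_chart_target E x)
    exact this (by rw [hx0]; exact hUn)
  have hsum : HasFDerivAt (V.coord x f ∘ (chartAt E x).symm) _ (chartAt E x x) :=
    (((toComplex n).hasFDerivAt.comp _ hcd).add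
      (HasFDerivAt.fun_sum (u := Finset.univ) fun i _ => (hφd i).smul (hgd i))).congr_of_eventuallyEq
      (by
        filter_upwards [hev] with z hz
        have := hAs _ hz
        rw [hA, realAddSpan_apply] at this
        exact this.symm)
  -- Leibniz rule for `f = c + ∑ φ_i g_i`. Apart from `dc`, only the terms `dφ_i g_i` can fail to be
  -- complex linear in `u`, and they lie in `F^0`.
  have hD (u : E) : V.ofCoord x x (Df u) = V.ofCoord x x (toComplex n (Dc u)) +
      (∑ i, (s x).2 i • V.ofCoord x x (Dg i u) + ∑ i, (Ds u).2 i • g i x) := by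
    have h := DFunLike.congr_fun (hfd.unique hsum) u
    simp only [ContinuousLinearMap.coe_restrictScalars', _root_.add_apply, _root_.sum_apply,
      ContinuousLinearMap.comp_apply, _root_.smul_apply, ContinuousLinearMap.smulRight_apply,
      Function.comp_apply, hx0, ContinuousLinearMap.coe_snd', ContinuousLinearMap.proj_apply] at h
    rw [h, ofCoord_add, ofCoord_sum, ← Finset.sum_add_distrib]
    simp only [ofCoord_add, ofCoord_smul, ofCoord_coord]
  have hle : V.F 0 x ≤ V.F (-1) x := (V.isHodge x).antitone (by norm_num)
  intro u
  constructor
  · rw [eq_sub_of_add_eq (hD u).symm]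
    refine sub_mem (hDfF u) (add_mem ?_ ?_)
    · exact Submodule.sum_mem _ fun i _ => Submodule.smul_mem _ _ (hDgF i u)
    · exact Submodule.sum_mem _ fun i _ => Submodule.smul_mem _ _ (hle (hgF x hxU i))
  · have h1 := hD (Complex.I • u)
    have h2 := hD u
    simp only [map_smul, ofCoord_smul] at h1
    have h3 : V.ofCoord x x (toComplex n (Dc (Complex.I • u))) -
        Complex.I • V.ofCoord x x (toComplex n (Dc u)) =
        Complex.I • ∑ i, (Ds u).2 i • g i x - ∑ i, (Ds (Complex.I • u)).2 i • g i x := by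
      have h4 : ∑ i, (s x).2 i • Complex.I • V.ofCoord x x (Dg i u) =
          Complex.I • ∑ i, (s x).2 i • V.ofCoord x x (Dg i u) := by
        rw [Finset.smul_sum]
        exact Finset.sum_congr rfl fun i _ => smul_comm _ _ _
      rw [h2, h4, smul_add, smul_add] at h1
      rw [eq_sub_iff_add_eq, ← sub_eq_zero]
      rw [← sub_eq_zero] at h1
      rw [← neg_eq_zero, ← h1]
      abel
    rw [h3]
    exact sub_mem (Submodule.smul_mem _ _ (Submodule.sum_mem _ fun i _ =>
      Submodule.smul_mem _ _ (hgF x hxU i))) (Submodule.sum_mem _ fun i _ =>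
      Submodule.smul_mem _ _ (hgF x hxU i))

end VHS

/-! ### Pull-back of an alternating form; integral-valued continuous functions -/

section

variable {E G : Type*} [NormedAddCommGroup E] [NormedSpace ℝ E] [NormedAddCommGroup G]
  [NormedSpace ℝ G]

/-- The pull-back along a linear map of an alternating bilinear form, as an alternating map. -/
noncomputable def alternatingPullback (B : G →L[ℝ] G →L[ℝ] ℝ) (hB : ∀ ξ, B ξ ξ = 0)
    (D : E →L[ℝ] G) : E [⋀^Fin 2]→L[ℝ] ℝ where
  toFun v := B (D (v 0)) (D (v 1))
  map_update_add' := by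
    intro inst v i a b
    -- The field quantifies over all decidability instances; the standard one lets `simp` evaluate
    -- the updates.
    obtain rfl := Subsingleton.elim inst (instDecidableEqFin 2)
    fin_cases i <;> simp
  map_update_smul' := by
    intro inst v i t a
    obtain rfl := Subsingleton.elim inst (instDecidableEqFin 2)
    fin_cases i <;> simp
  cont := by fun_prop
  map_eq_zero_of_eq' := by
    intro v i j h hij
    have h01 : v 0 = v 1 := by
      fin_cases i <;> fin_cases j <;> simp_all
    change B (D (v 0)) (D (v 1)) = 0
    rw [h01, hB]

end

/-- A continuous vector of real functions with integral values is locally constant. -/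
theorem eventually_eq_of_forall_int {X : Type*} [TopologicalSpace X] {n : ℕ}
    {d : X → Fin n → ℝ} {y : X} (hd : ContinuousAt d y)
    (h : ∀ᶠ z in 𝓝 y, ∃ m : Fin n → ℤ, ∀ i, d z i = m i) : ∀ᶠ z in 𝓝 y, d z = d y := by
  obtain ⟨m, hm⟩ := h.self_of_nhds
  filter_upwards [h, hd.eventually (Metric.ball_mem_nhds (d y) one_pos)] with z ⟨m', hm'⟩ hz
  funext i
  have h1 : dist (d z i) (d y i) < 1 := (dist_le_pi_dist _ _ i).trans_lt hz
  rw [hm i, hm' i, Real.dist_eq] at h1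
  rw [hm i, hm' i]
  have h2 : |m' i - m i| < 1 := by exact_mod_cast h1
  rw [Int.abs_lt_one_iff, sub_eq_zero] at h2
  rw [h2]

/-! ### Independence of the flat lift -/

namespace VHS

open LocalSystem

variable {E : Type*} [NormedAddCommGroup E] [NormedSpace ℂ E]
  {X : Type*} [TopologicalSpace X] [ChartedSpace E X] {n : ℕ}

theorem IsFlatLift.hasMFDerivAt {k : ℤ} {V : VHS E X n k} {ν : ∀ x, V.Jacobian x} {a : X}
    {U : Set X} {c : X → Fin n → ℝ} (hc : V.IsFlatLift ν a U c) {y : X} (hy : y ∈ U) :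
    ∃ D : E →L[ℝ] (Fin n → ℝ), HasMFDerivAt 𝓘(ℝ, E) 𝓘(ℝ, Fin n → ℝ) c y D :=
  ⟨_, ((hc.smooth.contMDiffAt (hc.isOpen.mem_nhds hy)).mdifferentiableAt (by simp)).hasMFDerivAt⟩

/-- Two flat lifts of the same section pull `ω_S` back to the same form: they differ by an
integral, hence locally constant, vector. -/
theorem IsFlatLift.coordForm_eq {V : VHS E X n (-1)} (S : V.WeakPolarization)
    {ν : ∀ x, V.Jacobian x} {a b : X} {U U' : Set X} {c c' : X → Fin n → ℝ}
    (hc : V.IsFlatLift ν a U c) (hc' : V.IsFlatLift ν b U' c') {y : X} (hy : y ∈ U)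
    (hy' : y ∈ U') {D D' : E →L[ℝ] (Fin n → ℝ)}
    (hD : HasMFDerivAt 𝓘(ℝ, E) 𝓘(ℝ, Fin n → ℝ) c y D)
    (hD' : HasMFDerivAt 𝓘(ℝ, E) 𝓘(ℝ, Fin n → ℝ) c' y D') (u w : E) :
    S.coordForm a y (D u) (D w) = S.coordForm b y (D' u) (D' w) := by
  -- The transition matrix is frozen at `y`: being locally constant, it is also correct nearby, and
  -- `T` contributes no derivative.
  set T : (Fin n → ℝ) →L[ℝ] (Fin n → ℝ) := LinearMap.toContinuousLinearMap
    (Matrix.mulVecLin (((V.frame a y).toMatrix (V.frame b y)).map (Int.cast : ℤ → ℝ))) with hT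
  set d : X → Fin n → ℝ := fun z => c z - T (c' z) with hd
  obtain ⟨hcc, hcD⟩ := hasMFDerivAt_iff_chartAt.1 hD
  obtain ⟨hcc', hcD'⟩ := hasMFDerivAt_iff_chartAt.1 hD'
  have hdc : ContinuousAt d y := hcc.sub (T.continuous.continuousAt.comp hcc')
  have hint : ∀ᶠ z in 𝓝 y, ∃ m : Fin n → ℤ, ∀ i, d z i = m i := by
    filter_upwards [V.transition a b y ⟨hc.subset_dom hy, hc'.subset_dom hy'⟩,
      hc.isOpen.mem_nhds hy, hc'.isOpen.mem_nhds hy'] with z hz hzU hzU'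
    refine V.exists_int_of_mem_periods a z (d z) ?_
    have h : V.proj z (V.ofCoord a z (toComplex n (c z))) =
        V.proj z (V.ofCoord b z (toComplex n (c' z))) :=
      (hc.lifts z hzU).trans (hc'.lifts z hzU').symm
    rw [V.ofCoord_toComplex_transition a b z, hz, proj_eq_proj_iff] at h
    rw [hd, map_sub, ofCoord_sub]
    exact h
  have hev := eventually_eq_of_forall_int hdc hint
  have hy0 : (chartAt E y).symm (chartAt E y y) = y :=
    (chartAt E y).left_inv (mem_chart_source E y)
  have htend : Filter.Tendsto (chartAt E y).symm (𝓝 (chartAt E y y)) (𝓝 y) := by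
    have := (chartAt E y).continuousAt_symm (mem_chart_target E y)
    rwa [ContinuousAt, hy0] at this
  have h1 : HasFDerivAt (d ∘ (chartAt E y).symm) (D - T ∘L D') (chartAt E y y) :=
    hcD.sub (T.hasFDerivAt.comp _ hcD')
  have h2 : HasFDerivAt (d ∘ (chartAt E y).symm) (0 : E →L[ℝ] (Fin n → ℝ)) (chartAt E y y) :=
    (hasFDerivAt_const (d y) _).congr_of_eventuallyEq (htend.eventually hev)
  have hDT (u : E) : D u = T (D' u) := by
    have := DFunLike.congr_fun (h1.unique h2) u
    exact sub_eq_zero.1 this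
  rw [S.coordForm_transition a b, hDT, hDT]
  rfl

/-- Through a flat lift `c` the pull-back of `ω_S` is `S(dc, dc)`. -/
theorem WeakPolarization.omega_mfderiv {k : ℤ} {V : VHS E X n k} (S : V.WeakPolarization) {a y : X}
    {c : X → Fin n → ℝ} {D : E →L[ℝ] (Fin n → ℝ)}
    (hD : HasMFDerivAt 𝓘(ℝ, E) 𝓘(ℝ, Fin n → ℝ) c y D) (u w : E) :
    S.omega a (y, c y)
        (mfderiv 𝓘(ℝ, E) (𝓘(ℝ, E).prod 𝓘(ℝ, Fin n → ℝ)) (fun z => (z, c z)) y u)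
        (mfderiv 𝓘(ℝ, E) (𝓘(ℝ, E).prod 𝓘(ℝ, Fin n → ℝ)) (fun z => (z, c z)) y w) =
      S.coordForm a y (D u) (D w) := by
  have h := ((hasMFDerivAt_id (I := 𝓘(ℝ, E)) y).prodMk hD).mfderiv
  change mfderiv 𝓘(ℝ, E) (𝓘(ℝ, E).prod 𝓘(ℝ, Fin n → ℝ)) (fun z => (z, c z)) y = _ at h
  rw [h]
  rfl

end VHS

/-! ### Uniqueness and smoothness of the pull-back -/

namespace TwoForm

open LocalSystem VHS

variable {E : Type*} [NormedAddCommGroup E] [NormedSpace ℂ E]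
  {X : Type*} [TopologicalSpace X] [ChartedSpace E X] {n : ℕ}

/-- The pull-back of `ω_S` is determined by flat lifts near each point. -/
theorem IsPullback.unique {k : ℤ} {V : VHS E X n k} {S : V.WeakPolarization}
    {ν : ∀ x, V.Jacobian x} (hex : ∀ x, ∃ U c, x ∈ U ∧ V.IsFlatLift ν x U c)
    {η η' : TwoForm E X} (h : η.IsPullback S ν) (h' : η'.IsPullback S ν) : η' = η := by
  funext x
  ext v
  obtain ⟨U, c, hx, hc⟩ := hex x
  have hv : v = ![v 0, v 1] := by
    funext i
    fin_cases i <;> rfl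
  rw [hv, h' x U c hc x hx, h x U c hc x hx]

/-- The pull-back of `ω_S` is smooth. -/
theorem IsPullback.isSmooth [IsManifold 𝓘(ℂ, E) ω X] {k : ℤ} {V : VHS E X n k}
    {S : V.WeakPolarization} {ν : ∀ x, V.Jacobian x}
    (hex : ∀ x, ∃ U c, x ∈ U ∧ V.IsFlatLift ν x U c) {η : TwoForm E X} (h : η.IsPullback S ν) :
    η.IsSmooth := by
  have : IsManifold 𝓘(ℝ, E) ∞ X := isManifold_real
  intro x u w z hz
  refine ContDiffAt.contDiffWithinAt ?_
  set e := (extChartAt 𝓘(ℝ, E) x).symm with he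
  set y := e z with hy
  obtain ⟨U, c, hyU, hc⟩ := hex y
  have hto : IsOpen (extChartAt 𝓘(ℝ, E) x).target := isOpen_extChartAt_target x
  have hsm : ContMDiffOn 𝓘(ℝ, E) 𝓘(ℝ, E) ∞ e (extChartAt 𝓘(ℝ, E) x).target :=
    contMDiffOn_extChartAt_symm x
  have htend : Filter.Tendsto e (𝓝 z) (𝓝 y) := (hsm.continuousOn.continuousAt (hto.mem_nhds hz))
  have hcz : ContDiffAt ℝ ∞ (c ∘ e) z :=
    contMDiffAt_iff_contDiffAt.1 ((hc.smooth.contMDiffAt (hc.isOpen.mem_nhds hyU)).comp z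
      (hsm.contMDiffAt (hto.mem_nhds hz)))
  have hfd : ContDiffAt ℝ ∞ (fderiv ℝ (c ∘ e)) z := hcz.fderiv_right (by simp)
  -- The coefficients of `S` are frozen at `y`; flatness makes them constant nearby, so only the
  -- derivative of `c ∘ e` varies.
  have hB : ContDiffAt ℝ ∞ (fun z' => S.coordFormCLM y y (fderiv ℝ (c ∘ e) z' u)
      (fderiv ℝ (c ∘ e) z' w)) z :=
    (((S.coordFormCLM y y).contDiff.contDiffAt.comp z (hfd.clm_apply contDiffAt_const))).clm_apply
      (hfd.clm_apply contDiffAt_const)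
  refine hB.congr_of_eventuallyEq ?_
  filter_upwards [htend.eventually (S.flat y y (V.mem_dom y)),
    htend.eventually (hc.isOpen.mem_nhds hyU), hto.mem_nhds hz] with z' hflat hz'U hz't
  rw [h y U c hc (e z') hz'U]
  obtain ⟨D, hD⟩ := hc.hasMFDerivAt hz'U
  obtain ⟨De, hDe⟩ : ∃ De : E →L[ℝ] E, HasMFDerivAt 𝓘(ℝ, E) 𝓘(ℝ, E) e z' De :=
    ⟨_, ((hsm.contMDiffAt (hto.mem_nhds hz't)).mdifferentiableAt (by simp)).hasMFDerivAt⟩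
  have hcomp : HasFDerivAt (c ∘ e) (D ∘L De) z' :=
    hasMFDerivAt_iff_hasFDerivAt.1 (hD.comp z' hDe)
  refine (S.omega_mfderiv hD _ _).trans ?_
  rw [hDe.mfderiv, hcomp.fderiv, S.coordFormCLM_apply]
  simp only [WeakPolarization.coordForm, hflat]
  rfl

end TwoForm

end NormalFunction

/-- Positivity: for a weight `-1` variation of Hodge structure `V` with a weak polarization `S` and
a normal function `ν`, the pull-back `ν^* ω_S` is a well-defined smooth 2-form, of type `(1,1)`
and non-negative. -/
theorem theorem12p1
    {E : Type*} [NormedAddCommGroup E] [NormedSpace ℂ E] [FiniteDimensional ℂ E]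
    {X : Type*} [TopologicalSpace X] [ChartedSpace E X] [IsManifold 𝓘(ℂ, E) ω X]
    {n : ℕ} (V : NormalFunction.VHS E X n (-1)) (S : V.WeakPolarization)
    (ν : ∀ x, V.Jacobian x) (hν : V.IsNormalFunction ν) :
    ∃ η : NormalFunction.TwoForm E X,
      η.IsPullback S ν ∧
      (∀ η' : NormalFunction.TwoForm E X, η'.IsPullback S ν → η' = η) ∧
      η.IsSmooth ∧ η.IsOneOne ∧ η.IsNonneg := by
  have hex (x : X) : ∃ U c, x ∈ U ∧ V.IsFlatLift ν x U c := by
    obtain ⟨U, c, D, hx, hc, -⟩ := hν.exists_isFlatLift x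
    exact ⟨U, c, hx, hc⟩
  choose U c D hxU hc hD hDF using hν.exists_isFlatLift
  -- At each `x` the lift centred at `x` is used. These choices are unrelated, and `coordForm_eq`
  -- reconciles them with every other flat lift.
  let η : NormalFunction.TwoForm E X := fun x => NormalFunction.alternatingPullback (E := E)
    (S.coordFormCLM x x) (fun ξ => by rw [S.coordFormCLM_apply, S.coordForm_self]) (D x)
  have hη (x : X) (u w : E) : η x ![u, w] = S.coordForm x x (D x u) (D x w) :=
    S.coordFormCLM_apply x x (D x u) (D x w)
  have hpull : η.IsPullback S ν := by
    intro a U' c' hc' y hy u w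
    obtain ⟨D', hD'⟩ := hc'.hasMFDerivAt hy
    exact (hη y u w).trans (((hc y).coordForm_eq S hc' (hxU y) hy (hD y) hD' u w).trans
      (S.omega_mfderiv hD' u w).symm)
  -- Applied to `d = dc(u)` and `e = dc(iu)`, which have `(-1,0)`-parts `α` and `iα`.
  have hdec (x : X) (u : E) := (V.isHodge x).exists_hodgePart_I_smul (hDF x u).1
    (hDF x (Complex.I • u)).1 (V.conjC_ofCoord_toComplex x x _)
    (V.conjC_ofCoord_toComplex x x _) (hDF x u).2
  refine ⟨η, hpull, fun η' h' => hpull.unique hex h', hpull.isSmooth hex, fun x u w => ?_,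
    fun x u => ?_⟩
  · obtain ⟨α, hα, h1, h2⟩ := hdec x u
    obtain ⟨β, hβ, h3, h4⟩ := hdec x w
    refine (hη x _ _).trans (Eq.trans ?_ (hη x _ _).symm)
    apply Complex.ofReal_injective
    rw [S.ofReal_coordForm, S.ofReal_coordForm]
    refine (congrArg₂ (fun v w => NormalFunction.complexify (S.form x) v w) h2 h4).trans
      (((S.isWeakPolarization x).complexify_I_smul hα hβ).trans
        (congrArg₂ (fun v w => NormalFunction.complexify (S.form x) v w) h1 h3).symm)
  · obtain ⟨α, hα, h1, h2⟩ := hdec x u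
    refine le_of_le_of_eq ?_ (hη x _ _).symm
    rw [← Complex.zero_le_real, S.ofReal_coordForm]
    exact le_of_le_of_eq ((S.isWeakPolarization x).complexify_I_smul_nonneg hα)
      (congrArg₂ (fun v w => NormalFunction.complexify (S.form x) v w) h1 h2).symm
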